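/- Let $q$ be an indeterminate. For an integer $m$ put $[m]=(1-q^m)/(1-q)$ (so $[m]=1+q+\cdots+q^{m-1}$ if $m\geq 1$), let $(a;q)_k=(1-a)(1-aq)\cdots(1-aq^{k-1})$ be the $q$-shifted factorial, and let $\Phi_n(q)$ be the $n$-th cyclotomic polynomial. For rational functions $A,B\in\mathbb{Q}(q)$ and a polynomial $P\in\mathbb{Q}[q]$ write $A\equiv B \pmod{P}$ if $P$ divides the numerator of $A-B$ written in lowest terms. Let $d,r,n$ be integers with $d\geq 3$, $r\leq d-2$ (in particular, $r$ may be negative) and $n\geq d-r$, such that $\gcd(d,r)=1$ and $n\equiv -r\pmod d$. Then $$\sum_{k=0}^{n-1}[2dk+r]\,\frac{(q^r;q^d)_k^{2d}}{(q^d;q^d)_k^{2d}}\,q^{d(d-1-r)k}\equiv 0\pmod{\Phi_n(q)^4}.$$ Moreover, $M=((d-1)n-r)/d$ is an integer with $0\leq M\leq n-1$, and $$\sum_{k=0}^{M}[2dk+r]\,\frac{(q^r;q^d)_k^{2d}}{(q^d;q^d)_k^{2d}}\,q^{d(d-1-r)k}\equiv 0\pmod{\Phi_n(q)^4}.$$ 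-/

import Mathlib

open Polynomial

/-- The `q`-shifted factorial `(a; q)_k = (1 - a) (1 - a q) ⋯ (1 - a q ^ (k - 1))`. -/
def qPochhammer {K : Type*} [CommRing K] (a q : K) (k : ℕ) : K :=
  ∏ i ∈ Finset.range k, (1 - a * q ^ i)

/-- The `q`-integer `[m] = (1 - q ^ m) / (1 - q)` for an arbitrary integer `m`. For a natural number
`m` this is `1 + q + ⋯ + q ^ (m - 1)` (see `qInt_natCast`), and `[-m] = - q ^ (-m) [m]`. -/
def qInt {K : Type*} [Field K] (q : K) (m : ℤ) : K :=
  (1 - q ^ m) / (1 - q)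

theorem qInt_natCast {K : Type*} [Field K] (q : K) (hq : q ≠ 1) (m : ℕ) :
    qInt q (m : ℤ) = ∑ i ∈ Finset.range m, q ^ i := by
  rw [qInt, zpow_natCast, geom_sum_eq hq, ← neg_sub (q ^ m) 1, ← neg_sub q 1, neg_div_neg_eq]

/-- Congruence `A ≡ B (mod P)` of two rational functions in one indeterminate over `ℚ` modulo a
polynomial `P`: the numerator of `A - B`, written in lowest terms, is divisible by `P` (so that the
denominator of `A - B` is coprime to `P`). -/
def RatFuncCongr (P : ℚ[X]) (A B : RatFunc ℚ) : Prop :=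
  P ∣ (A - B).num

/-- The `k`-th term
`[2dk + r] (q^r; q^d)_k^(2d) / (q^d; q^d)_k^(2d) q^(d (d - 1 - r) k)`. -/
noncomputable def qSummand {K : Type*} [Field K] (q : K) (d : ℕ) (r : ℤ) (k : ℕ) : K :=
  qInt q (2 * (d : ℤ) * (k : ℤ) + r)
    * (qPochhammer (q ^ r) (q ^ d) k ^ (2 * d) / qPochhammer (q ^ d) (q ^ d) k ^ (2 * d))
    * q ^ ((d : ℤ) * ((d : ℤ) - 1 - r) * (k : ℤ))

/-! Put D = d - 1 and r + n = d(N + 1); then M = n - 1 - N = DN + (d - 1 - r). A term with M < k ≤ n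
- 1 contains the factor 1 - q^(Dn) to the power 2d ≥ 4, so both claims reduce to the sum up to M,
whose denominators are cleared by a factor independent of k.

The 2d equal factors of a term are deformed by replacing q^r by q^(r + ny) with separate shifts y
(`shiftedFac`). When the shifts are 0, -D and D pairs t, 1 - t, the deformed sum vanishes
identically (`sum_wellPoisedWeight_mul_prod_shiftedFac`). Indeed each pair is, up to a constant and
a power of q, a polynomial of degree N in the node x_k = q^(-dk) + q^(r + dk), while the remaining
factors amount to a constant over ∏_{j ≠ k} (x_k - x_j). By Lagrange interpolation the sum is a
constant times the coefficient of X^M in a polynomial of degree DN < M.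

Modulo Φ_n^4 one can write q^n = exp l with l^4 = 0. The factor with shift y is then the undeformed
one times exp(l α_k y + l² β_k y² + l³ γ_k y³). The shifts add up to 0, so every choice of the t
gives a linear relation between the wanted sum S1 and l² S2, l³ S3, where S2 and S3 are weighted by
β_k and γ_k. Modulo l the undeformed terms are odd and γ_k is even under k ↦ M - k, whence l³ S3 =
0. Two choices of t then eliminate l² S2 and leave S1 = 0 (`sum_wellPoised_eq_zero_of_paired`). The
deformed identity is proved for generic q and specialised to ℚ[X]/(Φ_n^4) through Laurent
polynomials. -/

/-- The power `q ^ m` of a unit, as an element of the ring. -/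
def unitPow {A : Type*} [CommRing A] (q : Aˣ) (m : ℤ) : A := ((q ^ m : Aˣ) : A)

/-! ### Powers of a unit and the deformed summands. -/

section Defs

variable {A B : Type*} [CommRing A] [CommRing B]

theorem unitPow_add (q : Aˣ) (a b : ℤ) : unitPow q (a + b) = unitPow q a * unitPow q b := by
  simp [unitPow, zpow_add]

theorem unitPow_zero (q : Aˣ) : unitPow q 0 = 1 := by simp [unitPow]

theorem unitPow_mul_natCast (q : Aˣ) (a : ℤ) (k : ℕ) : unitPow q (a * k) = unitPow q a ^ k := by
  simp [unitPow, zpow_mul]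

theorem isUnit_unitPow (q : Aˣ) (a : ℤ) : IsUnit (unitPow q a) := Units.isUnit _

theorem map_unitPow (f : A →+* B) (q : Aˣ) (a : ℤ) :
    f (unitPow q a) = unitPow (Units.map (f : A →* B) q) a := by
  unfold unitPow
  rw [← map_zpow]
  rfl

theorem unitPow_eq_zpow {K : Type*} [Field K] (q : Kˣ) (a : ℤ) : unitPow q a = (q : K) ^ a := by
  simp [unitPow]

/-- The product `(q ^ (r + n y); q ^ d)_k (q ^ (d (k + 1) - n y); q ^ d)_(M - k)`. -/
def shiftedFac (q : Aˣ) (d n : ℕ) (r : ℤ) (M k : ℕ) (y : ℤ) : A :=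
  (∏ j ∈ Finset.range k, (1 - unitPow q (r + d * j + n * y))) *
    ∏ j ∈ Finset.Ico k M, (1 - unitPow q (d * (j + 1) - n * y))

/-- The very-well-poised weight `(1 - q ^ (r + 2 d k)) q ^ (d (d - 1 - r) k)`. -/
def wellPoisedWeight (q : Aˣ) (d : ℕ) (r : ℤ) (k : ℕ) : A :=
  (1 - unitPow q (r + 2 * d * k)) * unitPow q (d * (d - 1 - r) * k)

theorem map_shiftedFac (f : A →+* B) (q : Aˣ) (d n : ℕ) (r : ℤ) (M k : ℕ) (y : ℤ) :
    f (shiftedFac q d n r M k y) = shiftedFac (Units.map (f : A →* B) q) d n r M k y := by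
  simp [shiftedFac, map_prod, map_unitPow]

theorem map_wellPoisedWeight (f : A →+* B) (q : Aˣ) (d : ℕ) (r : ℤ) (k : ℕ) :
    f (wellPoisedWeight q d r k) = wellPoisedWeight (Units.map (f : A →* B) q) d r k := by
  simp [wellPoisedWeight, map_unitPow]

end Defs

/-! ### Rearrangement of finite products. -/

section Products

variable {A : Type*} [CommRing A]

/-- The two sides differ only by moving the segment between k and N from one product to the other.
This trades the k-dependent range [k, M) for the fixed range [N, M) and a window of fixed length N.
-/
theorem prod_Ico_mul_prod_Ico_swap (f : ℕ → A) {k N M : ℕ} (hk : k ≤ M) (hN : N ≤ M) :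
    (∏ i ∈ Finset.Ico N (N + k), f i) * ∏ i ∈ Finset.Ico k M, f i =
      (∏ i ∈ Finset.Ico k (k + N), f i) * ∏ i ∈ Finset.Ico N M, f i := by
  rcases le_total k N with h | h
  · rw [← Finset.prod_Ico_consecutive f h hN,
      ← Finset.prod_Ico_consecutive f h (by omega : N ≤ k + N), add_comm N k]
    ring
  · rw [← Finset.prod_Ico_consecutive f h hk,
      ← Finset.prod_Ico_consecutive f h (by omega : k ≤ N + k), add_comm N k]
    ring

theorem prod_range_shift (f : ℕ → A) (a k : ℕ) :
    ∏ j ∈ Finset.range k, f (a + j) = ∏ i ∈ Finset.Ico a (a + k), f i := by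
  rw [Finset.prod_Ico_eq_prod_range]
  simp

theorem prod_range_erase (f : ℕ → A) {k M : ℕ} (hk : k ≤ M) :
    ∏ j ∈ (Finset.range (M + 1)).erase k, f j =
      (∏ j ∈ Finset.range k, f j) * ∏ j ∈ Finset.range (M - k), f (k + 1 + j) := by
  rw [prod_range_shift, ← Finset.prod_union]
  · congr 1
    ext j
    simp only [Finset.mem_erase, Finset.mem_range, Finset.mem_union, Finset.mem_Ico]
    omega
  · rw [Finset.disjoint_left]
    intro j
    simp only [Finset.mem_range, Finset.mem_Ico]
    omega

end Products

/-! ### The deformed sum as a Lagrange interpolation coefficient. -/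

section KarlssonMinton

variable {A : Type*} [CommRing A] (q : Aˣ) (d n : ℕ) (r : ℤ) (M N : ℕ)

/-- The nodes `q ^ (-d k) + q ^ (r + d k)` of the partial fraction expansion. -/
def wellPoisedNode (k : ℕ) : A := unitPow q (-(d * k)) + unitPow q (r + d * k)

/-- Since r + n = d(N + 1), the first product for 1 - t continues the second product for t with an
index shift N, and vice versa, so all but N factors of each kind become independent of k. The
survivors combine two by two: (1 - u)(1 - v) with uv = q^(r + 2dk) is q^(dk) times the node minus a
constant. -/
theorem shiftedFac_mul_shiftedFac_one_sub (hN : r + n = d * (N + 1)) (hNM : N ≤ M) {k : ℕ}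
    (hk : k ≤ M) (t : ℤ) :
    shiftedFac q d n r M k t * shiftedFac q d n r M k (1 - t) =
      (∏ i ∈ Finset.Ico N M, (1 - unitPow q (d * (i + 1) - n * t))) *
        (∏ i ∈ Finset.Ico N M, (1 - unitPow q (r + d * (i - N) + n * t))) *
        (unitPow q (d * N * k) *
        ∏ m ∈ Finset.range N, (wellPoisedNode q d r k -
          (unitPow q (d * (m + 1) - n * t) + unitPow q (r - d * (m + 1) + n * t)))) := by
  have h1 := prod_Ico_mul_prod_Ico_swap
    (fun i : ℕ => 1 - unitPow q ((d : ℤ) * (i + 1) - n * t)) hk hNM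
  have h2 := prod_Ico_mul_prod_Ico_swap
    (fun i : ℕ => 1 - unitPow q (r + (d : ℤ) * (i - N) + n * t)) hk hNM
  rw [← prod_range_shift, ← prod_range_shift] at h1
  rw [← prod_range_shift, ← prod_range_shift, ← Finset.prod_range_reflect _ N] at h2
  have e1 : ∏ j ∈ Finset.range k, (1 - unitPow q (r + d * j + n * (1 - t))) =
      ∏ j ∈ Finset.range k, (1 - unitPow q ((d : ℤ) * (((N + j : ℕ) : ℤ) + 1) - n * t)) := by
    refine Finset.prod_congr rfl fun j _ => ?_
    congr 2
    push_cast
    linear_combination hN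
  have e2 : ∏ j ∈ Finset.range k, (1 - unitPow q (r + d * j + n * t)) =
      ∏ j ∈ Finset.range k, (1 - unitPow q (r + (d : ℤ) * (((N + j : ℕ) : ℤ) - N) + n * t)) := by
    refine Finset.prod_congr rfl fun j _ => ?_
    congr 2
    push_cast
    ring
  have e3 : ∏ j ∈ Finset.Ico k M, (1 - unitPow q (d * (j + 1) - n * (1 - t))) =
      ∏ j ∈ Finset.Ico k M, (1 - unitPow q (r + (d : ℤ) * (j - N) + n * t)) := by
    refine Finset.prod_congr rfl fun j _ => ?_
    congr 2
    linear_combination -hN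
  have e4 : unitPow q (d * N * k) *
      ∏ m ∈ Finset.range N, (wellPoisedNode q d r k -
        (unitPow q (d * (m + 1) - n * t) + unitPow q (r - d * (m + 1) + n * t))) =
      (∏ m ∈ Finset.range N, (1 - unitPow q ((d : ℤ) * (((k + m : ℕ) : ℤ) + 1) - n * t))) *
      ∏ m ∈ Finset.range N,
        (1 - unitPow q (r + (d : ℤ) * (((k + (N - 1 - m) : ℕ) : ℤ) - N) + n * t)) := by
    rw [← Finset.prod_mul_distrib, show (d : ℤ) * N * k = d * k * N by ring, unitPow_mul_natCast]
    nth_rw 1 [← Finset.card_range N]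
    rw [← Finset.prod_const, ← Finset.prod_mul_distrib]
    refine Finset.prod_congr rfl fun m hm => ?_
    have hm' : m < N := Finset.mem_range.1 hm
    have : ((k + (N - 1 - m) : ℕ) : ℤ) = k + N - 1 - m := by omega
    rw [this]
    push_cast
    set u := unitPow q ((d : ℤ) * (k + m + 1) - n * t) with hu
    have i1 : unitPow q ((d : ℤ) * k) * unitPow q (-(d * k)) = 1 := by
      rw [← unitPow_add, ← unitPow_zero q]; congr 1; ring
    have i2 : unitPow q ((d : ℤ) * k) * unitPow q (r + d * k) =
        u * unitPow q (r + d * (k + N - 1 - m - N) + n * t) := by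
      rw [← unitPow_add, hu, ← unitPow_add]; congr 1; ring
    have i3 : unitPow q ((d : ℤ) * k) * unitPow q (d * (m + 1) - n * t) = u := by
      rw [← unitPow_add, hu]; congr 1; ring
    have i4 : unitPow q ((d : ℤ) * k) * unitPow q (r - d * (m + 1) + n * t) =
        unitPow q (r + d * (k + N - 1 - m - N) + n * t) := by
      rw [← unitPow_add]; congr 1; ring
    rw [wellPoisedNode]
    linear_combination i1 + i2 - i3 - i4
  rw [e4, shiftedFac, shiftedFac, e1, e2, e3]
  linear_combination (∏ j ∈ Finset.range k,
    (1 - unitPow q (r + (d : ℤ) * (((N + j : ℕ) : ℤ) - N) + n * t))) *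
    (∏ j ∈ Finset.Ico k M, (1 - unitPow q (r + (d : ℤ) * (j - N) + n * t))) * h1 +
    (∏ m ∈ Finset.range N, (1 - unitPow q ((d : ℤ) * (((k + m : ℕ) : ℤ) + 1) - n * t))) *
    (∏ i ∈ Finset.Ico N M, (1 - unitPow q ((d : ℤ) * (i + 1) - n * t))) * h2

/-- The difference of nodes x_k - x_j is q^(-dk) (1 - q^(d(k-j))) (1 - q^(r + d(k+j))). Because Dn =
dM + r, the shift -D supplies exactly the factors needed to complete these to products that no
longer depend on k. -/
theorem wellPoisedWeight_mul_prod_node_sub (D : ℕ)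
    (hM : (d : ℤ) * M = D * n - r) (hND : (M : ℤ) = D * N + (d - 1 - r)) {k : ℕ} (hk : k ≤ M) :
    wellPoisedWeight q d r k * shiftedFac q d n r M k 0 * shiftedFac q d n r M k (-D) *
        unitPow q (d * N * k) ^ D *
        ∏ j ∈ (Finset.range (M + 1)).erase k, (wellPoisedNode q d r k - wellPoisedNode q d r j) =
      (∏ i ∈ Finset.range (2 * M + 1), (1 - unitPow q (r + d * i))) *
        (∏ i ∈ Finset.range M, (1 - unitPow q (d * (i + 1)))) *
        ∏ i ∈ Finset.range M, (1 - unitPow q (-(d * (i + 1)))) := by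
  have e1 : ∏ j ∈ (Finset.range (M + 1)).erase k,
      (wellPoisedNode q d r k - wellPoisedNode q d r j) =
      unitPow q (-(d * k) * M) *
      ((∏ j ∈ Finset.range k, (1 - unitPow q (d * (j + 1)))) *
        ∏ j ∈ Finset.range (M - k), (1 - unitPow q (-(d * (j + 1))))) *
      ∏ j ∈ (Finset.range (M + 1)).erase k, (1 - unitPow q (r + d * (k + j))) := by
    have : ∏ j ∈ (Finset.range (M + 1)).erase k,
        (wellPoisedNode q d r k - wellPoisedNode q d r j) =
        ∏ j ∈ (Finset.range (M + 1)).erase k, (unitPow q (-(d * k)) *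
          (1 - unitPow q (d * (k - j))) * (1 - unitPow q (r + d * (k + j)))) := by
      refine Finset.prod_congr rfl fun j _ => ?_
      have i1 : unitPow q (-((d : ℤ) * j)) = unitPow q (-(d * k)) * unitPow q (d * (k - j)) := by
        rw [← unitPow_add]; congr 1; ring
      have i2 : unitPow q (r + (d : ℤ) * j) = unitPow q (-(d * k)) *
          unitPow q (r + d * (k + j)) := by
        rw [← unitPow_add]; congr 1; ring
      have i3 : unitPow q (r + (d : ℤ) * k) = unitPow q (-(d * k)) *
          unitPow q (d * (k - j)) * unitPow q (r + d * (k + j)) := by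
        rw [← unitPow_add, ← unitPow_add]; congr 1; ring
      rw [wellPoisedNode, wellPoisedNode, i1, i2, i3]
      ring
    rw [this, Finset.prod_mul_distrib, Finset.prod_mul_distrib, Finset.prod_const,
      Finset.card_erase_of_mem (by simp; omega), Finset.card_range, unitPow_mul_natCast,
      prod_range_erase (fun j : ℕ => 1 - unitPow q ((d : ℤ) * (k - j))) hk,
      ← Finset.prod_range_reflect (fun j : ℕ => 1 - unitPow q ((d : ℤ) * (k - j))) k]
    congr 3
    · refine Finset.prod_congr rfl fun j hj => ?_
      have := Finset.mem_range.1 hj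
      have : ((k - 1 - j : ℕ) : ℤ) = k - 1 - j := by omega
      rw [this]
      congr 2
      ring
    · refine Finset.prod_congr rfl fun j hj => ?_
      congr 2
      push_cast
      ring
  -- The weight is the factor j = k missing from the erased product. The factors 1 - q^(r + di) thus
  -- cover [0, k), [k, k + M + 1) and [k + M + 1, 2M + 1), the outer two coming from the shifts 0
  -- and -D.
  have e2 : (1 - unitPow q (r + 2 * d * k)) *
      ∏ j ∈ (Finset.range (M + 1)).erase k, (1 - unitPow q (r + d * (k + j))) =
      ∏ i ∈ Finset.Ico k (k + (M + 1)), (1 - unitPow q (r + d * i)) := by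
    rw [← prod_range_shift, ← Finset.mul_prod_erase (Finset.range (M + 1)) _
      (Finset.mem_range.2 (by omega : k < M + 1))]
    congr 1
    congr 2; push_cast; ring
  have e3 : ∏ j ∈ Finset.Ico k M, (1 - unitPow q ((d : ℤ) * (j + 1) - n * (-D))) =
      ∏ i ∈ Finset.Ico (k + (M + 1)) (2 * M + 1), (1 - unitPow q (r + d * i)) := by
    rw [show 2 * M + 1 = M + (M + 1) by ring,
      ← Finset.prod_Ico_add' (fun i : ℕ => 1 - unitPow q (r + (d : ℤ) * i)) k M (M + 1)]
    refine Finset.prod_congr rfl fun j hj => ?_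
    congr 2
    push_cast
    linear_combination -hM
  have e4 : ∏ j ∈ Finset.range k, (1 - unitPow q (r + d * j + n * (-D))) =
      ∏ i ∈ Finset.Ico (M - k) M, (1 - unitPow q (-(d * (i + 1)))) := by
    have hkM : M = (M - k) + k := by omega
    conv_rhs => rw [hkM]
    rw [show M - k + k - k = M - k by omega, ← prod_range_shift, ← Finset.prod_range_reflect]
    refine Finset.prod_congr rfl fun j hj => ?_
    have := Finset.mem_range.1 hj
    have h1 : ((M - k + j : ℕ) : ℤ) = M - k + j := by omega
    have h2 : ((k - 1 - j : ℕ) : ℤ) = k - 1 - j := by omega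
    rw [h1, h2]
    congr 2
    linear_combination hM
  -- The exponent d(d - 1 - r)k of the summand is the one that makes all k-dependent powers of q
  -- cancel.
  have e5 : unitPow q (d * (d - 1 - r) * k) * unitPow q (d * N * k) ^ D *
      unitPow q (-(d * k) * M) = 1 := by
    rw [← unitPow_mul_natCast, ← unitPow_add, ← unitPow_add, ← unitPow_zero q]
    congr 1
    linear_combination -(d : ℤ) * k * hND
  have e6 : shiftedFac q d n r M k 0 = (∏ j ∈ Finset.range k, (1 - unitPow q (r + d * j))) *
      ∏ j ∈ Finset.Ico k M, (1 - unitPow q (d * (j + 1))) := by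
    simp [shiftedFac]
  have f1 := Finset.prod_range_mul_prod_Ico (fun i : ℕ => 1 - unitPow q (r + (d : ℤ) * i))
    (by omega : k + (M + 1) ≤ 2 * M + 1)
  have f1' := Finset.prod_range_mul_prod_Ico (fun i : ℕ => 1 - unitPow q (r + (d : ℤ) * i))
    (by omega : k ≤ k + (M + 1))
  have f2 := Finset.prod_range_mul_prod_Ico (fun i : ℕ => 1 - unitPow q ((d : ℤ) * (i + 1))) hk
  have f3 := Finset.prod_range_mul_prod_Ico (fun i : ℕ => 1 - unitPow q (-((d : ℤ) * (i + 1))))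
    (by omega : M - k ≤ M)
  rw [e1, e6, shiftedFac, e3, e4, ← f1, ← f1', ← f2, ← f3, ← e2, wellPoisedWeight]
  linear_combination ((1 - unitPow q (r + 2 * d * k)) *
    ((∏ j ∈ Finset.range k, (1 - unitPow q (r + d * j))) *
      ∏ j ∈ Finset.Ico k M, (1 - unitPow q (d * (j + 1)))) *
    ((∏ i ∈ Finset.Ico (M - k) M, (1 - unitPow q (-(d * (i + 1))))) *
    ∏ i ∈ Finset.Ico (k + (M + 1)) (2 * M + 1), (1 - unitPow q (r + d * i))) *
    ((∏ j ∈ Finset.range k, (1 - unitPow q (d * (j + 1)))) *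
        ∏ j ∈ Finset.range (M - k), (1 - unitPow q (-(d * (j + 1))))) *
      ∏ j ∈ (Finset.range (M + 1)).erase k, (1 - unitPow q (r + d * (k + j)))) * e5

end KarlssonMinton

/-- A terminating very-well-poised summation of Karlsson–Minton type. -/
theorem sum_wellPoisedWeight_mul_prod_shiftedFac {K : Type*} [Field K] (q : Kˣ)
    (hq : ∀ m : ℤ, unitPow q m = 1 → m = 0) (d n : ℕ) (r : ℤ) (M N D : ℕ) (hd : d = D + 1)
    (hr : ∀ m : ℤ, r + d * m ≠ 0)
    (hM : (d : ℤ) * M = D * n - r) (hND : (M : ℤ) = D * N + (d - 1 - r))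
    (hN : r + n = d * (N + 1)) (hDN : D * N < M) (hNM : N ≤ M) (t : ℕ → ℤ) :
    ∑ k ∈ Finset.range (M + 1), wellPoisedWeight q d r k * shiftedFac q d n r M k 0 *
      shiftedFac q d n r M k (-D) * ∏ i ∈ Finset.range D,
        (shiftedFac q d n r M k (t i) * shiftedFac q d n r M k (1 - t i)) = 0 := by
  -- The nodes are distinct because q is not a root of unity and d does not divide r.
  have hinj : Set.InjOn (wellPoisedNode q d r) (Finset.range (M + 1) : Finset ℕ) := by
    intro k _ j _ hkj
    have i1 : unitPow q (-((d : ℤ) * j)) = unitPow q (-(d * k)) * unitPow q (d * (k - j)) := by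
      rw [← unitPow_add]; congr 1; ring
    have i2 : unitPow q (r + (d : ℤ) * j) = unitPow q (-(d * k)) *
        unitPow q (r + d * (k + j)) := by
      rw [← unitPow_add]; congr 1; ring
    have i3 : unitPow q (r + (d : ℤ) * k) = unitPow q (-(d * k)) *
        unitPow q (d * (k - j)) * unitPow q (r + d * (k + j)) := by
      rw [← unitPow_add, ← unitPow_add]; congr 1; ring
    rw [wellPoisedNode, wellPoisedNode, i1, i2, i3] at hkj
    have : unitPow q (-((d : ℤ) * k)) * ((1 - unitPow q (d * (k - j))) *
        (1 - unitPow q (r + d * (k + j)))) = 0 := by linear_combination hkj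
    rw [(isUnit_unitPow q _).mul_right_eq_zero, mul_eq_zero, sub_eq_zero, sub_eq_zero] at this
    rcases this with h | h
    · have := hq _ h.symm
      rw [mul_eq_zero] at this
      rcases this with h | h
      · omega
      · omega
    · exact absurd (hq _ h.symm) (hr _)
  set P : K[X] := ∏ i ∈ Finset.range D, ∏ m ∈ Finset.range N, (X - C
    (unitPow q ((d : ℤ) * (m + 1) - n * t i) + unitPow q (r - d * (m + 1) + n * t i))) with hP
  have hmonic : P.Monic := monic_prod_of_monic _ _ fun i _ =>
    monic_prod_of_monic _ _ fun m _ => monic_X_sub_C _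
  have hdeg : P.natDegree = D * N := by
    rw [hP, natDegree_prod_of_monic _ _ fun i _ => monic_prod_of_monic _ _ fun m _ =>
      monic_X_sub_C _]
    have : ∀ i ∈ Finset.range D, (∏ m ∈ Finset.range N, (X - C
        (unitPow q ((d : ℤ) * (m + 1) - n * t i) +
          unitPow q (r - d * (m + 1) + n * t i)))).natDegree = N := by
      intro i _
      rw [natDegree_prod_of_monic _ _ fun m _ => monic_X_sub_C _]
      simp only [natDegree_X_sub_C]
      simp
    rw [Finset.sum_congr rfl this]
    simp
  have hdeg' : P.degree < (Finset.range (M + 1)).card := by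
    rw [degree_eq_natDegree hmonic.ne_zero, hdeg, Finset.card_range]
    exact_mod_cast (by omega : D * N < M + 1)
  -- With M + 1 nodes this expresses the coefficient of X^M, which is zero as the degree is DN < M.
  have key := Lagrange.coeff_eq_sum hinj hdeg'
  rw [coeff_eq_zero_of_natDegree_lt (by rw [hdeg]; simpa using hDN)] at key
  set C1 : K := ∏ i ∈ Finset.range D,
    ((∏ j ∈ Finset.Ico N M, (1 - unitPow q ((d : ℤ) * (j + 1) - n * t i))) *
      (∏ j ∈ Finset.Ico N M, (1 - unitPow q (r + (d : ℤ) * (j - N) + n * t i)))) with hC1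
  set C2 : K := (∏ i ∈ Finset.range (2 * M + 1), (1 - unitPow q (r + (d : ℤ) * i))) *
        (∏ i ∈ Finset.range M, (1 - unitPow q ((d : ℤ) * (i + 1)))) *
        ∏ i ∈ Finset.range M, (1 - unitPow q (-((d : ℤ) * (i + 1)))) with hC2
  have : ∀ k ∈ Finset.range (M + 1), wellPoisedWeight q d r k * shiftedFac q d n r M k 0 *
      shiftedFac q d n r M k (-D) * ∏ i ∈ Finset.range D,
        (shiftedFac q d n r M k (t i) * shiftedFac q d n r M k (1 - t i)) =
      C1 * C2 * (P.eval (wellPoisedNode q d r k) /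
        ∏ j ∈ (Finset.range (M + 1)).erase k,
          (wellPoisedNode q d r k - wellPoisedNode q d r j)) := by
    intro k hk
    have hk' : k ≤ M := by have := Finset.mem_range.1 hk; omega
    have hne : ∏ j ∈ (Finset.range (M + 1)).erase k,
        (wellPoisedNode q d r k - wellPoisedNode q d r j) ≠ 0 := by
      rw [Finset.prod_ne_zero_iff]
      intro j hj h
      rw [Finset.mem_erase] at hj
      exact hj.1 (hinj (Finset.mem_coe.2 hj.2) (Finset.mem_coe.2 hk) (sub_eq_zero.1 h).symm)
    rw [hC2, ← wellPoisedWeight_mul_prod_node_sub q d n r M N D hM hND hk',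
      Finset.prod_congr rfl fun i _ =>
        shiftedFac_mul_shiftedFac_one_sub q d n r M N hN hNM hk' (t i), hC1, hP]
    simp only [Finset.prod_mul_distrib, Finset.prod_const, Finset.card_range, eval_prod, eval_sub,
      eval_X, eval_C]
    field_simp
  rw [Finset.sum_congr rfl this, ← Finset.mul_sum, ← key, mul_zero]

/-! ### Truncated exponential and logarithm at order four. -/

section TruncExp

variable {A : Type*} [CommRing A]

/-- The exponential series of `l * x`, truncated at order four in `l`; here `c` stands
for `1 / 6`. -/
def truncExp (c l x : A) : A := 1 + l * x + 3 * c * (l * x) ^ 2 + c * (l * x) ^ 3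

theorem truncExp_zero (c l : A) : truncExp c l 0 = 1 := by simp [truncExp]

variable {c l : A}

theorem truncExp_add (hc : 6 * c = 1) (hl : l ^ 4 = 0) (x y : A) :
    truncExp c l (x + y) = truncExp c l x * truncExp c l y := by
  unfold truncExp
  linear_combination (-3 * c * x * y ^ 2 * x - c * x * y ^ 3 - c * x ^ 3 * y
    + 3 * c * x ^ 2 * y ^ 2 - 9 * c ^ 2 * x ^ 2 * y ^ 2
    - 3 * c ^ 2 * l * x ^ 2 * y ^ 3 - 3 * c ^ 2 * l * x ^ 3 * y ^ 2
    - c ^ 2 * l ^ 2 * x ^ 3 * y ^ 3) * hl + l ^ 2 * x * y * hc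

theorem truncExp_natCast_mul (hc : 6 * c = 1) (hl : l ^ 4 = 0) (m : ℕ) (x : A) :
    truncExp c l (m * x) = truncExp c l x ^ m := by
  induction m with
  | zero => simp [truncExp_zero]
  | succ m ih => rw [Nat.cast_succ, add_mul, one_mul, truncExp_add hc hl, ih, pow_succ]

theorem unitPow_mul_eq_truncExp (hc : 6 * c = 1) (hl : l ^ 4 = 0) (q : Aˣ) (n : ℕ)
    (hq : unitPow q n = truncExp c l 1) (y : ℤ) : unitPow q (n * y) = truncExp c l y := by
  have hnat : ∀ m : ℕ, unitPow q ((n : ℤ) * m) = truncExp c l m := fun m => by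
    rw [unitPow_mul_natCast, hq, ← truncExp_natCast_mul hc hl, mul_one]
  obtain ⟨m, rfl | rfl⟩ := y.eq_nat_or_neg
  · simpa using hnat m
  · have h1 : unitPow q ((n : ℤ) * m) * unitPow q ((n : ℤ) * (-m)) = 1 := by
      rw [← unitPow_add, ← unitPow_zero q]; congr 1; ring
    have h2 : truncExp c l (m : A) * truncExp c l ((-(m : ℤ) : ℤ) : A) = 1 := by
      rw [← truncExp_add hc hl, ← truncExp_zero c l]; congr 1; simp
    rw [← hnat] at h2
    exact (isUnit_unitPow q _).mul_left_cancel (h1.trans h2.symm)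

/-- As 3c = 1/2 and 2c = 1/3, the argument is log(1 + e) modulo e^4. -/
theorem truncExp_log (hc : 6 * c = 1) {e : A} (he : e ^ 4 = 0) :
    truncExp c (e - 3 * c * e ^ 2 + 2 * c * e ^ 3) 1 = 1 + e := by
  unfold truncExp
  grind

/-- The cubic `s + 3 s ^ 2 + 2 s ^ 3` governing the third order term of `log (1 - s (exp y - 1))`. -/
def logCubic (s : A) : A := s + 3 * s ^ 2 + 2 * s ^ 3

/-- With s = x / (1 - x), 1 - x exp(ly) = (1 - x)(1 - s(exp(ly) - 1)); the exponent is the logarithm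
of the last factor, expanded to third order. -/
theorem one_sub_mul_truncExp (hc : 6 * c = 1) (hl : l ^ 4 = 0) {x i : A} (hi : (1 - x) * i = 1)
    (y : A) : 1 - x * truncExp c l y = (1 - x) * truncExp c l (-(x * i) * y +
      l * (-(3 * c * (x * i + (x * i) ^ 2))) * y ^ 2 + l ^ 2 * (-(c * logCubic (x * i))) * y ^ 3) := by
  have hs : ∀ s : A, 1 - s * (truncExp c l y - 1) = truncExp c l (-s * y +
      l * (-(3 * c * (s + s ^ 2))) * y ^ 2 + l ^ 2 * (-(c * logCubic s)) * y ^ 3) := by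
    intro s
    unfold truncExp logCubic
    have hz : (l * y) ^ 4 = 0 := by rw [mul_pow, hl, zero_mul]
    grind
  rw [← hs]
  linear_combination (x * (truncExp c l y - 1)) * hi

end TruncExp

/-! ### Third order logarithmic expansion of the deformed factors. -/

section Expansion

variable {A : Type*} [CommRing A] {c l : A}

/-- `f y` is `f 0` times the truncated exponential of a cubic polynomial in `y` without constant
term, whose coefficients have orders one, two and three in `l`, the last one being `l ^ 3 * γ`. -/
def HasCubicLog (c l : A) (f : ℤ → A) (γ : A) : Prop :=
  ∃ α β : A, ∀ y : ℤ, f y = f 0 * truncExp c l (α * y + l * β * y ^ 2 + l ^ 2 * γ * y ^ 3)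

theorem HasCubicLog.mul (hc : 6 * c = 1) (hl : l ^ 4 = 0) {f g : ℤ → A} {γ δ : A}
    (hf : HasCubicLog c l f γ) (hg : HasCubicLog c l g δ) :
    HasCubicLog c l (fun y => f y * g y) (γ + δ) := by
  obtain ⟨α, β, h⟩ := hf
  obtain ⟨α', β', h'⟩ := hg
  refine ⟨α + α', β + β', fun y => ?_⟩
  have : (α + α') * (y : A) + l * (β + β') * y ^ 2 + l ^ 2 * (γ + δ) * y ^ 3 =
    (α * y + l * β * y ^ 2 + l ^ 2 * γ * y ^ 3) +
      (α' * y + l * β' * y ^ 2 + l ^ 2 * δ * y ^ 3) := by ring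
  beta_reduce
  rw [this, truncExp_add hc hl, h y, h' y]
  ring

theorem HasCubicLog.prod (hc : 6 * c = 1) (hl : l ^ 4 = 0) {ι : Type*} (s : Finset ι)
    {f : ι → ℤ → A} {γ : ι → A} (h : ∀ i ∈ s, HasCubicLog c l (f i) (γ i)) :
    HasCubicLog c l (fun y => ∏ i ∈ s, f i y) (∑ i ∈ s, γ i) := by
  classical
  induction s using Finset.induction_on with
  | empty => exact ⟨0, 0, fun y => by simp [truncExp_zero]⟩
  | insert a s ha ih =>
    simp only [Finset.prod_insert ha, Finset.sum_insert ha]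
    exact (h a (Finset.mem_insert_self a s)).mul hc hl
      (ih fun i hi => h i (Finset.mem_insert_of_mem hi))

variable {q : Aˣ} {n : ℕ} {inv : ℤ → A}

theorem hasCubicLog_one_sub (hc : 6 * c = 1) (hl : l ^ 4 = 0) (hq : unitPow q n = truncExp c l 1)
    (hinv : ∀ m : ℤ, ¬ (n : ℤ) ∣ m → (1 - unitPow q m) * inv m = 1) {m : ℤ} (hm : ¬ (n : ℤ) ∣ m) :
    HasCubicLog c l (fun y => 1 - unitPow q (m + n * y))
      (-(c * logCubic (unitPow q m * inv m))) := by
  refine ⟨-(unitPow q m * inv m), -(3 * c * (unitPow q m * inv m + (unitPow q m * inv m) ^ 2)),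
    fun y => ?_⟩
  beta_reduce
  rw [unitPow_add, unitPow_mul_eq_truncExp hc hl q n hq, one_sub_mul_truncExp hc hl (hinv m hm)]
  simp

theorem HasCubicLog.comp_neg {f : ℤ → A} {γ : A} (hf : HasCubicLog c l f γ) :
    HasCubicLog c l (fun y => f (-y)) (-γ) := by
  obtain ⟨α, β, h⟩ := hf
  refine ⟨-α, β, fun y => ?_⟩
  beta_reduce
  rw [h (-y), neg_zero]
  congr 2
  push_cast
  ring

/-- Up to the factor `c`, the third logarithmic derivative of `shiftedFac`. -/
def shiftedFacCubic (q : Aˣ) (inv : ℤ → A) (d : ℕ) (r : ℤ) (M k : ℕ) : A :=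
  (∑ j ∈ Finset.Ico k M, logCubic (unitPow q (d * (j + 1)) * inv (d * (j + 1)))) -
    ∑ j ∈ Finset.range k, logCubic (unitPow q (r + d * j) * inv (r + d * j))

theorem hasCubicLog_shiftedFac (hc : 6 * c = 1) (hl : l ^ 4 = 0)
    (hq : unitPow q n = truncExp c l 1)
    (hinv : ∀ m : ℤ, ¬ (n : ℤ) ∣ m → (1 - unitPow q m) * inv m = 1) {d : ℕ} {r : ℤ} {M k : ℕ}
    (hk : k ≤ M) (h1 : ∀ j < M, ¬ (n : ℤ) ∣ r + d * j)
    (h2 : ∀ j < M, ¬ (n : ℤ) ∣ (d : ℤ) * (j + 1)) :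
    HasCubicLog c l (shiftedFac q d n r M k) (c * shiftedFacCubic q inv d r M k) := by
  have e1 := HasCubicLog.prod hc hl (Finset.range k) fun j hj =>
    hasCubicLog_one_sub hc hl hq hinv (h1 j (by have := Finset.mem_range.1 hj; omega))
  have e2 := HasCubicLog.prod hc hl (Finset.Ico k M) fun j hj =>
    (hasCubicLog_one_sub hc hl hq hinv (h2 j (Finset.mem_Ico.1 hj).2)).comp_neg
  have e3 := e1.mul hc hl e2
  convert e3 using 1
  · funext y
    simp [shiftedFac, sub_eq_add_neg]
  · rw [shiftedFacCubic, mul_sub, Finset.mul_sum, Finset.mul_sum]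
    simp only [neg_neg, Finset.sum_neg_distrib]
    ring

end Expansion

/-! ### The symmetry k ↦ M - k when q^n = 1. -/

section Reflection

variable {A : Type*} [CommRing A] {q : Aˣ} {n : ℕ}

theorem unitPow_congr (hq : unitPow q n = 1) {a b : ℤ} (h : (n : ℤ) ∣ a - b) :
    unitPow q a = unitPow q b := by
  obtain ⟨m, hm⟩ := h
  have hq' : q ^ (n : ℤ) = 1 := Units.ext hq
  rw [show a = b + n * m by linear_combination hm, unitPow_add]
  simp [unitPow, zpow_mul, hq']

variable {d : ℕ} {r : ℤ} {M : ℕ} {D : ℕ}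

/-- When q^n = 1, q^(r + dj) is the inverse of q^(d(M - j)), and 1 - u = -u(1 - u⁻¹). Squaring
removes the sign. -/
theorem prod_one_sub_eq_prod_reflect (hq : unitPow q n = 1) (hM : (d : ℤ) * M = D * n - r) {k : ℕ}
    (hk : k ≤ M) :
    (∏ j ∈ Finset.range k, (1 - unitPow q (r + d * j))) ^ 2 =
      unitPow q (-(d * k * (2 * M - k + 1))) *
        (∏ j ∈ Finset.Ico (M - k) M, (1 - unitPow q (d * (j + 1)))) ^ 2 := by
  induction k with
  | zero => simp [unitPow_zero]
  | succ k ih =>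
    rw [Finset.prod_range_succ, mul_pow, ih (by omega),
      show M - k = M - (k + 1) + 1 by omega,
      Finset.prod_eq_prod_Ico_succ_bot (by omega : M - (k + 1) < M), mul_pow,
      unitPow_congr hq (⟨D, by linear_combination hM⟩ : (n : ℤ) ∣ r + d * k - (d * (k - M)))]
    have hc : ((M - (k + 1) : ℕ) : ℤ) = M - (k + 1) := by omega
    rw [hc]
    have i1 : unitPow q (-((d : ℤ) * ((k + 1 : ℕ) : ℤ) * (2 * M - ((k + 1 : ℕ) : ℤ) + 1))) =
        unitPow q (-(d * k * (2 * M - k + 1))) * unitPow q (d * (k - M)) ^ 2 := by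
      rw [sq, ← unitPow_add, ← unitPow_add]
      congr 1
      push_cast
      ring
    have i2 : unitPow q ((d : ℤ) * (k - M)) * unitPow q (d * (M - (k + 1) + 1)) = 1 := by
      rw [← unitPow_add, ← unitPow_zero q]; congr 1; ring
    rw [i1]
    set u := unitPow q ((d : ℤ) * (k - M))
    set v := unitPow q ((d : ℤ) * (M - (k + 1) + 1))
    have : (1 - u) ^ 2 = u ^ 2 * (1 - v) ^ 2 := by
      linear_combination (2 * u - u * v - 1) * i2
    rw [this]
    ring

/-- In this form the first bracket is odd under k ↦ M - k and all other factors are even. -/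
theorem wellPoised_term_eq (hq : unitPow q n = 1) (hM : (d : ℤ) * M = D * n - r) {k : ℕ}
    (hk : k ≤ M) :
    wellPoisedWeight q d r k * shiftedFac q d n r M k 0 ^ (2 * d) =
      (unitPow q (-(d * k)) - unitPow q (-(d * (M - k)))) *
        unitPow q (-(d * d * k * (M - k))) *
        ((∏ j ∈ Finset.Ico (M - k) M, (1 - unitPow q (d * (j + 1)))) *
          ∏ j ∈ Finset.Ico k M, (1 - unitPow q (d * (j + 1)))) ^ (2 * d) := by
  have e1 : shiftedFac q d n r M k 0 ^ (2 * d) = unitPow q (-(d * k * (2 * M - k + 1)) * d) *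
      ((∏ j ∈ Finset.Ico (M - k) M, (1 - unitPow q (d * (j + 1)))) *
          ∏ j ∈ Finset.Ico k M, (1 - unitPow q (d * (j + 1)))) ^ (2 * d) := by
    rw [unitPow_mul_natCast, pow_mul, pow_mul, ← mul_pow]
    congr 1
    have := prod_one_sub_eq_prod_reflect hq hM hk
    simp only [shiftedFac, mul_zero, add_zero, sub_zero]
    rw [mul_pow, this]
    ring
  rw [e1, ← mul_assoc]
  congr 1
  have e2 : unitPow q (r + 2 * d * k) = unitPow q (d * (2 * k - M)) :=
    unitPow_congr hq ⟨D, by linear_combination hM⟩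
  have e3 : unitPow q (d * (d - 1 - r) * k) = unitPow q (d * (d - 1 + d * M) * k) :=
    unitPow_congr hq ⟨-(D * d * k), by linear_combination -(d : ℤ) * k * hM⟩
  have e4 : unitPow q (-((d : ℤ) * (M - k))) =
      unitPow q (-(d * k)) * unitPow q (d * (2 * k - M)) := by
    rw [← unitPow_add]; congr 1; ring
  have e5 : unitPow q ((d : ℤ) * (d - 1 + d * M) * k) *
      unitPow q (-(d * k * (2 * M - k + 1)) * d) =
      unitPow q (-(d * k)) * unitPow q (-(d * d * k * (M - k))) := by
    rw [← unitPow_add, ← unitPow_add]; congr 1; ring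
  rw [wellPoisedWeight, e2, e3, e4, mul_assoc, e5]
  ring

theorem wellPoised_term_reflect (hq : unitPow q n = 1) (hM : (d : ℤ) * M = D * n - r) {k : ℕ}
    (hk : k ≤ M) :
    wellPoisedWeight q d r (M - k) * shiftedFac q d n r M (M - k) 0 ^ (2 * d) =
      -(wellPoisedWeight q d r k * shiftedFac q d n r M k 0 ^ (2 * d)) := by
  rw [wellPoised_term_eq hq hM hk, wellPoised_term_eq hq hM (Nat.sub_le M k),
    Nat.sub_sub_self hk, Nat.cast_sub hk,
    show (d : ℤ) * d * (M - k) * (M - (M - k)) = d * d * k * (M - k) by ring,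
    show (M : ℤ) - (M - k) = k by ring]
  ring

/-- The cubic is s(1 + s)(1 + 2s), odd under s ↦ -1 - s, which for s = x / (1 - x) is x ↦ 1/x.
Reflection therefore turns the second sum into one of the first kind, and the result is visibly even
under k ↦ M - k. -/
theorem shiftedFacCubic_eq (hq : unitPow q n = 1) (hM : (d : ℤ) * M = D * n - r) {inv : ℤ → A}
    (hinv : ∀ m : ℤ, ¬ (n : ℤ) ∣ m → (1 - unitPow q m) * inv m = 1)
    (h1 : ∀ j < M, ¬ (n : ℤ) ∣ r + d * j) (h2 : ∀ j < M, ¬ (n : ℤ) ∣ (d : ℤ) * (j + 1))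
    {k : ℕ} (hk : k ≤ M) :
    shiftedFacCubic q inv d r M k =
      (∑ j ∈ Finset.Ico k M, logCubic (unitPow q (d * (j + 1)) * inv (d * (j + 1)))) +
      ∑ j ∈ Finset.Ico (M - k) M, logCubic (unitPow q (d * (j + 1)) * inv (d * (j + 1))) := by
  have e1 : ∑ j ∈ Finset.Ico (M - k) M,
      logCubic (unitPow q (d * (j + 1)) * inv (d * (j + 1))) =
      ∑ j ∈ Finset.range k, -logCubic (unitPow q (r + d * j) * inv (r + d * j)) := by
    rw [Finset.sum_Ico_eq_sum_range, show M - (M - k) = k by omega, ← Finset.sum_range_reflect]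
    refine Finset.sum_congr rfl fun j hj => ?_
    have hj' := Finset.mem_range.1 hj
    have hinv1 := hinv _ (h1 j (by omega))
    have hinv2 := hinv _ (h2 (M - k + (k - 1 - j)) (by omega))
    have i2 : unitPow q (r + (d : ℤ) * j) *
        unitPow q (d * (((M - k + (k - 1 - j) : ℕ) : ℤ) + 1)) = 1 := by
      have hc : ((M - k + (k - 1 - j) : ℕ) : ℤ) = M - 1 - j := by omega
      rw [hc, ← unitPow_add, ← unitPow_zero q]
      exact unitPow_congr hq ⟨D, by linear_combination hM⟩
    set x := unitPow q (r + (d : ℤ) * j)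
    set x' := unitPow q (d * (((M - k + (k - 1 - j) : ℕ) : ℤ) + 1))
    set i := inv (r + (d : ℤ) * j)
    set i' := inv (d * (((M - k + (k - 1 - j) : ℕ) : ℤ) + 1))
    have : x' * i' = -1 - x * i := by
      linear_combination (-x' * i' - x * i - 1) * hinv1 - i * i' * i2 - i * hinv2 +
        x * i * hinv1
    rw [this, logCubic, logCubic]
    ring
  rw [e1, shiftedFacCubic, Finset.sum_neg_distrib, sub_eq_add_neg]

/-- An odd term times an even cubic gives S = -S, and 2 is invertible with inverse 3c. -/
theorem sum_wellPoised_mul_cubic_eq_zero (hq : unitPow q n = 1) (hM : (d : ℤ) * M = D * n - r)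
    {inv : ℤ → A} (hinv : ∀ m : ℤ, ¬ (n : ℤ) ∣ m → (1 - unitPow q m) * inv m = 1)
    (h1 : ∀ j < M, ¬ (n : ℤ) ∣ r + d * j) (h2 : ∀ j < M, ¬ (n : ℤ) ∣ (d : ℤ) * (j + 1))
    {c : A} (hc : 6 * c = 1) :
    ∑ k ∈ Finset.range (M + 1), wellPoisedWeight q d r k * shiftedFac q d n r M k 0 ^ (2 * d) *
      shiftedFacCubic q inv d r M k = 0 := by
  set S := ∑ k ∈ Finset.range (M + 1), wellPoisedWeight q d r k *
    shiftedFac q d n r M k 0 ^ (2 * d) * shiftedFacCubic q inv d r M k with hS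
  have : S = -S := by
    conv_lhs => rw [hS, ← Finset.sum_range_reflect]
    rw [hS, ← Finset.sum_neg_distrib]
    refine Finset.sum_congr rfl fun k hk => ?_
    have hk' : k ≤ M := by have := Finset.mem_range.1 hk; omega
    rw [show M + 1 - 1 - k = M - k by omega, wellPoised_term_reflect hq hM hk',
      shiftedFacCubic_eq hq hM hinv h1 h2 hk', shiftedFacCubic_eq hq hM hinv h1 h2 (Nat.sub_le M k),
      Nat.sub_sub_self hk']
    ring
  linear_combination 3 * c * this - S * hc

end Reflection

/-! ### From the deformed sums to the undeformed one. -/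

/-- If the very-well-poised sums with one parameter `q ^ (r - D n)` and the others paired vanish, then
so does the undeformed sum, in any ring where `(q ^ n - 1) ^ 4 = 0`. -/
theorem sum_wellPoised_eq_zero_of_paired {A : Type*} [CommRing A] {c : A} (hc : 6 * c = 1)
    {q : Aˣ} {n d D M : ℕ} {r : ℤ} (hq : (unitPow q n - 1) ^ 4 = 0) {inv : ℤ → A}
    (hinv : ∀ m : ℤ, ¬ (n : ℤ) ∣ m → (1 - unitPow q m) * inv m = 1)
    (hd : d = D + 1) (hD : 1 ≤ D) (hM : (d : ℤ) * M = D * n - r)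
    (h1 : ∀ j < M, ¬ (n : ℤ) ∣ r + d * j) (h2 : ∀ j < M, ¬ (n : ℤ) ∣ (d : ℤ) * (j + 1))
    (hpair : ∀ t : ℕ → ℤ,
      ∑ k ∈ Finset.range (M + 1), wellPoisedWeight q d r k * shiftedFac q d n r M k 0 *
      shiftedFac q d n r M k (-D) * ∏ i ∈ Finset.range D,
        (shiftedFac q d n r M k (t i) * shiftedFac q d n r M k (1 - t i)) = 0) :
    ∑ k ∈ Finset.range (M + 1), wellPoisedWeight q d r k * shiftedFac q d n r M k 0 ^ (2 * d) =
      0 := by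
  -- From here on `D` stands for d - 2, so that one of the d - 1 pairs can be split off.
  obtain ⟨D, rfl⟩ : ∃ D', D = D' + 1 := ⟨D - 1, by omega⟩
  set e := unitPow q n - 1 with he
  set l : A := e - 3 * c * e ^ 2 + 2 * c * e ^ 3 with hldef
  have hl : l ^ 4 = 0 := by
    rw [hldef, show e - 3 * c * e ^ 2 + 2 * c * e ^ 3 = e * (1 - 3 * c * e + 2 * c * e ^ 2) by ring,
      mul_pow, hq, zero_mul]
  have hql : unitPow q n = truncExp c l 1 := by
    rw [truncExp_log hc hq, he]
    ring
  have hlog : ∀ k, ∃ α β : A, k ≤ M → ∀ y : ℤ, shiftedFac q d n r M k y =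
      shiftedFac q d n r M k 0 * truncExp c l
        (α * y + l * β * y ^ 2 + l ^ 2 * (c * shiftedFacCubic q inv d r M k) * y ^ 3) := by
    intro k
    by_cases hk : k ≤ M
    · obtain ⟨α, β, h⟩ := hasCubicLog_shiftedFac hc hl hql hinv hk h1 h2
      exact ⟨α, β, fun _ => h⟩
    · exact ⟨0, 0, fun h => absurd h hk⟩
  choose α β hlog using hlog
  have hE : ∀ u : A, truncExp c l (l * u) = 1 + l ^ 2 * u := by
    intro u
    unfold truncExp
    linear_combination (3 * c * u ^ 2 + c * u ^ 3 * l ^ 2) * hl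
  set S1 := ∑ k ∈ Finset.range (M + 1),
    wellPoisedWeight q d r k * shiftedFac q d n r M k 0 ^ (2 * d) with hS1
  set S2 := ∑ k ∈ Finset.range (M + 1),
    wellPoisedWeight q d r k * shiftedFac q d n r M k 0 ^ (2 * d) * β k with hS2
  set S3 := ∑ k ∈ Finset.range (M + 1), wellPoisedWeight q d r k *
    shiftedFac q d n r M k 0 ^ (2 * d) * shiftedFacCubic q inv d r M k with hS3
  -- Since l^4 = 0, it suffices that S3 vanishes modulo l, where q^n = 1 and the reflection applies.
  have h3 : l ^ 3 * S3 = 0 := by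
    let f := Ideal.Quotient.mk (Ideal.span {l})
    have hfl : f l = 0 := Ideal.Quotient.eq_zero_iff_mem.2 (Ideal.mem_span_singleton_self l)
    have hfc : 6 * f c = 1 := by rw [← map_one f, ← hc, map_mul, map_ofNat]
    have hfq : unitPow (Units.map (f : A →* A ⧸ Ideal.span {l}) q) n = 1 := by
      rw [← map_unitPow, hql, truncExp]
      simp [hfl]
    have := sum_wellPoised_mul_cubic_eq_zero (inv := fun m => f (inv m)) hfq hM
      (fun m hm => by rw [← map_unitPow, ← map_one f, ← map_sub, ← map_mul, hinv m hm]) h1 h2 hfc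
    have hS : f S3 = 0 := by
      rw [← this, hS3, map_sum]
      refine Finset.sum_congr rfl fun k _ => ?_
      rw [map_mul, map_mul, map_pow, map_wellPoisedWeight, map_shiftedFac]
      congr 1
      have f2 : f 2 = 2 := map_ofNat f 2
      have f3 : f 3 = 3 := map_ofNat f 3
      simp [shiftedFacCubic, logCubic, map_unitPow, f2, f3]
    obtain ⟨u, hu⟩ := Ideal.mem_span_singleton.1 (Ideal.Quotient.eq_zero_iff_mem.1 hS)
    rw [hu]
    linear_combination u * hl
  -- Replacing one pair (0, 1) by (2, -1) keeps the sum of the shifts at 0, and raises the sum of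
  -- squares by 4 and the sum of cubes by 6.
  have hp1 := hpair fun _ => 0
  have hp2 := hpair fun i => if i = 0 then 2 else 0
  have e1 : S1 + l ^ 2 * (((D + 1 : ℕ) : A) ^ 2 + (D + 1 : ℕ)) * S2 +
      l ^ 3 * c * ((D + 1 : ℕ) - ((D + 1 : ℕ) : A) ^ 3) * S3 = 0 := by
    rw [← hp1, hS1, hS2, hS3, Finset.mul_sum, Finset.mul_sum, ← Finset.sum_add_distrib,
      ← Finset.sum_add_distrib]
    refine Finset.sum_congr rfl fun k hk => ?_
    have hk' : k ≤ M := by have := Finset.mem_range.1 hk; omega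
    have hg := hlog k hk'
    rw [Finset.prod_const, Finset.card_range, hg (-((D + 1 : ℕ) : ℤ)), hg (1 - 0)]
    set g0 := shiftedFac q d n r M k 0
    have key : truncExp c l (α k * ((-((D + 1 : ℕ) : ℤ) : ℤ) : A) +
        l * β k * ((-((D + 1 : ℕ) : ℤ) : ℤ) : A) ^ 2 +
        l ^ 2 * (c * shiftedFacCubic q inv d r M k) * ((-((D + 1 : ℕ) : ℤ) : ℤ) : A) ^ 3) *
        truncExp c l (α k * ((1 - 0 : ℤ) : A) + l * β k * ((1 - 0 : ℤ) : A) ^ 2 +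
        l ^ 2 * (c * shiftedFacCubic q inv d r M k) * ((1 - 0 : ℤ) : A) ^ 3) ^ (D + 1) =
        1 + l ^ 2 * ((((D + 1 : ℕ) : A) ^ 2 + (D + 1 : ℕ)) * β k +
          l * c * ((D + 1 : ℕ) - ((D + 1 : ℕ) : A) ^ 3) * shiftedFacCubic q inv d r M k) := by
      rw [← truncExp_natCast_mul hc hl, ← truncExp_add hc hl, ← hE]
      congr 1
      push_cast
      ring
    rw [show ∀ w a b : A, w * g0 * (g0 * a) * (g0 * (g0 * b)) ^ (D + 1) =
      w * g0 ^ (2 * d) * (a * b ^ (D + 1)) by intro w a b; rw [hd]; ring, key]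
    ring
  have e2 : S1 + l ^ 2 * (((D + 1 : ℕ) : A) ^ 2 + (D + 1 : ℕ) + 4) * S2 +
      l ^ 3 * c * ((D + 1 : ℕ) - ((D + 1 : ℕ) : A) ^ 3 + 6) * S3 = 0 := by
    rw [← hp2, hS1, hS2, hS3, Finset.mul_sum, Finset.mul_sum, ← Finset.sum_add_distrib,
      ← Finset.sum_add_distrib]
    refine Finset.sum_congr rfl fun k hk => ?_
    have hk' : k ≤ M := by have := Finset.mem_range.1 hk; omega
    have hg := hlog k hk'
    rw [Finset.prod_range_succ']
    simp only [Nat.add_eq_zero_iff, one_ne_zero, and_false, if_false, if_true]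
    rw [Finset.prod_const, Finset.card_range, hg (-((D + 1 : ℕ) : ℤ)), hg (1 - 0), hg 2,
      hg (1 - 2)]
    set g0 := shiftedFac q d n r M k 0
    have key : truncExp c l (α k * ((-((D + 1 : ℕ) : ℤ) : ℤ) : A) +
        l * β k * ((-((D + 1 : ℕ) : ℤ) : ℤ) : A) ^ 2 +
        l ^ 2 * (c * shiftedFacCubic q inv d r M k) * ((-((D + 1 : ℕ) : ℤ) : ℤ) : A) ^ 3) *
        truncExp c l (α k * ((1 - 0 : ℤ) : A) + l * β k * ((1 - 0 : ℤ) : A) ^ 2 +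
        l ^ 2 * (c * shiftedFacCubic q inv d r M k) * ((1 - 0 : ℤ) : A) ^ 3) ^ D *
        (truncExp c l (α k * ((2 : ℤ) : A) + l * β k * ((2 : ℤ) : A) ^ 2 +
        l ^ 2 * (c * shiftedFacCubic q inv d r M k) * ((2 : ℤ) : A) ^ 3) *
        truncExp c l (α k * ((1 - 2 : ℤ) : A) + l * β k * ((1 - 2 : ℤ) : A) ^ 2 +
        l ^ 2 * (c * shiftedFacCubic q inv d r M k) * ((1 - 2 : ℤ) : A) ^ 3)) =
        1 + l ^ 2 * ((((D + 1 : ℕ) : A) ^ 2 + (D + 1 : ℕ) + 4) * β k +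
          l * c * ((D + 1 : ℕ) - ((D + 1 : ℕ) : A) ^ 3 + 6) *
            shiftedFacCubic q inv d r M k) := by
      rw [← truncExp_natCast_mul hc hl, ← truncExp_add hc hl, ← truncExp_add hc hl,
        ← truncExp_add hc hl, ← hE]
      congr 1
      push_cast
      ring
    rw [show ∀ w a b b' b'' : A, w * g0 * (g0 * a) * ((g0 * (g0 * b)) ^ D *
      (g0 * b' * (g0 * b''))) = w * g0 ^ (2 * d) * (a * b ^ D * (b' * b'')) by
        intro w a b b' b''; rw [hd]; ring, key]
    ring
  -- The difference of the two relations is 4 l² S2 plus a multiple of l³ S3; the factor 9c² is 1/4.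
  have h4 : l ^ 2 * S2 = 0 := by
    linear_combination 9 * c ^ 2 * e2 - 9 * c ^ 2 * e1 - 9 * c ^ 2 * 6 * c * h3 -
      (6 * c + 1) * (l ^ 2 * S2) * hc
  linear_combination e1 - (((D + 1 : ℕ) : A) ^ 2 + (D + 1 : ℕ)) * h4 -
    c * ((D + 1 : ℕ) - ((D + 1 : ℕ) : A) ^ 3) * h3

/-! ### Specialisation of the generic identity through Laurent polynomials. -/

open LaurentPolynomial in
/-- The indeterminate as a unit of the ring of Laurent polynomials. -/
noncomputable def laurentUnit : (ℚ[T;T⁻¹])ˣ where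
  val := T 1
  inv := T (-1)
  val_inv := by rw [← T_add]; simp
  inv_val := by rw [← T_add]; simp

open LaurentPolynomial in
theorem unitPow_laurentUnit (m : ℤ) : unitPow laurentUnit m = T m := by
  obtain ⟨k, rfl | rfl⟩ := m.eq_nat_or_neg
  · rw [unitPow, zpow_natCast, Units.val_pow_eq_pow_val, laurentUnit, T_pow]
    simp
  · rw [unitPow, zpow_neg, zpow_natCast, ← inv_pow, Units.val_pow_eq_pow_val]
    change T (-1) ^ k = _
    rw [T_pow]
    simp

open LaurentPolynomial in
theorem map_laurentUnit {A : Type*} [CommRing A] [Algebra ℚ A] (q : Aˣ) :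
    Units.map (eval₂ (algebraMap ℚ A) q : ℚ[T;T⁻¹] →* A) laurentUnit = q := by
  ext
  change eval₂ (algebraMap ℚ A) q (T 1) = q
  simp

/-- The vanishing of the paired sums over an arbitrary `ℚ`-algebra. -/
theorem sum_wellPoisedWeight_mul_prod_shiftedFac_algebra {A : Type*} [CommRing A] [Algebra ℚ A]
    (q : Aˣ) (d n : ℕ) (r : ℤ) (M N D : ℕ) (hd : d = D + 1)
    (hr : ∀ m : ℤ, r + d * m ≠ 0)
    (hM : (d : ℤ) * M = D * n - r) (hND : (M : ℤ) = D * N + (d - 1 - r))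
    (hN : r + n = d * (N + 1)) (hDN : D * N < M) (hNM : N ≤ M) (t : ℕ → ℤ) :
    ∑ k ∈ Finset.range (M + 1), wellPoisedWeight q d r k * shiftedFac q d n r M k 0 *
      shiftedFac q d n r M k (-D) * ∏ i ∈ Finset.range D,
        (shiftedFac q d n r M k (t i) * shiftedFac q d n r M k (1 - t i)) = 0 := by
  -- The field version applies to the indeterminate in the fraction field; injectivity brings the
  -- identity back to Laurent polynomials, and evaluation carries it to any unit.
  let L := LaurentPolynomial ℚ
  let f := algebraMap L (FractionRing L)
  have hf : Function.Injective f := IsFractionRing.injective L (FractionRing L)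
  have hfield := sum_wellPoisedWeight_mul_prod_shiftedFac
    (Units.map (f : L →* FractionRing L) laurentUnit) (fun m hm => by
      rw [← map_unitPow, ← map_one f, unitPow_laurentUnit] at hm
      exact (AddMonoidAlgebra.single_left_inj one_ne_zero).1 (hf hm)) d n r M N D hd hr hM hND hN hDN hNM t
  have hL : ∑ k ∈ Finset.range (M + 1), wellPoisedWeight laurentUnit d r k *
      shiftedFac laurentUnit d n r M k 0 *
      shiftedFac laurentUnit d n r M k (-D) * ∏ i ∈ Finset.range D,
        (shiftedFac laurentUnit d n r M k (t i) *
          shiftedFac laurentUnit d n r M k (1 - t i)) = 0 := by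
    apply hf
    rw [map_zero, ← hfield, map_sum]
    simp only [map_mul, map_prod, map_wellPoisedWeight, map_shiftedFac]
  have := congrArg (LaurentPolynomial.eval₂ (algebraMap ℚ A) q) hL
  rw [map_zero, map_sum] at this
  simpa only [map_mul, map_prod, map_wellPoisedWeight, map_shiftedFac, map_laurentUnit] using this

/-! ### Divisibility of the cleared sum by Φ_n^4. -/

section Cyclotomic

theorem isCoprime_X_cyclotomic {n : ℕ} (hn : 0 < n) : IsCoprime (X : ℚ[X]) (cyclotomic n ℚ) := by
  obtain ⟨g, hg⟩ := cyclotomic.dvd_X_pow_sub_one n ℚ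
  refine ⟨X ^ (n - 1), -g, ?_⟩
  rw [← pow_succ, Nat.sub_add_cancel hn]
  linear_combination hg

theorem isCoprime_one_sub_X_pow_cyclotomic {n m : ℕ} (h : ¬ n ∣ m) :
    IsCoprime (1 - X ^ m : ℚ[X]) (cyclotomic n ℚ) := by
  have hm : 0 < m := Nat.pos_of_ne_zero fun h0 => h (h0 ▸ dvd_zero n)
  rw [← neg_sub, IsCoprime.neg_left_iff, ← prod_cyclotomic_eq_X_pow_sub_one hm]
  refine IsCoprime.prod_left fun e he => cyclotomic.isCoprime_rat ?_
  rintro rfl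
  exact h (Nat.dvd_of_mem_divisors he)

variable {n : ℕ}

theorem isUnit_adjoinRoot_mk {P p : ℚ[X]} (h : IsCoprime p P) : IsUnit (AdjoinRoot.mk P p) := by
  obtain ⟨u, v, huv⟩ := h
  refine IsUnit.of_mul_eq_one (AdjoinRoot.mk P u) ?_
  rw [← map_mul, ← map_one (AdjoinRoot.mk P), ← huv, map_add, map_mul _ v, AdjoinRoot.mk_self,
    mul_zero, add_zero, mul_comm]

theorem exists_one_sub_unitPow_mul_eq_one {A : Type*} [CommRing A] {q : Aˣ}
    (h : ∀ m : ℕ, ¬ n ∣ m → IsUnit (1 - (q : A) ^ m)) (m : ℤ) (hm : ¬ (n : ℤ) ∣ m) :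
    ∃ i, (1 - unitPow q m) * i = 1 := by
  have key : ∀ k : ℕ, ¬ n ∣ k → ∃ i, (1 - unitPow q k) * i = 1 := fun k hk => by
    have := (h k hk).exists_right_inv
    simpa [unitPow] using this
  obtain ⟨k, rfl | rfl⟩ := m.eq_nat_or_neg
  · exact key k (by rwa [Int.natCast_dvd_natCast] at hm)
  · obtain ⟨i, hi⟩ := key k (by rwa [dvd_neg, Int.natCast_dvd_natCast] at hm)
    refine ⟨-unitPow q k * i, ?_⟩
    have : unitPow q k * unitPow q (-k) = 1 := by
      rw [← unitPow_add, ← unitPow_zero q]; congr 1; ring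
    linear_combination hi + i * this

/-- The undeformed cleared sum, up to a power of `x`, is a polynomial multiple of `Φ_n ^ 4`. -/
theorem exists_sum_wellPoised_eq (d : ℕ) (r : ℤ) (M N D : ℕ) (hn : 0 < n) (hd : d = D + 1) (hD : 1 ≤ D)
    (hr : ∀ m : ℤ, r + d * m ≠ 0)
    (hM : (d : ℤ) * M = D * n - r) (hND : (M : ℤ) = D * N + (d - 1 - r))
    (hN : r + n = d * (N + 1)) (hDN : D * N < M) (hNM : N ≤ M)
    (h1 : ∀ j < M, ¬ (n : ℤ) ∣ r + d * j) (h2 : ∀ j < M, ¬ (n : ℤ) ∣ (d : ℤ) * (j + 1))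
    {K : Type*} [Field K] [Algebra ℚ[X] K] [Algebra ℚ K] [IsScalarTower ℚ ℚ[X] K]
    (x : Kˣ) (hx : (x : K) = algebraMap ℚ[X] K X) :
    ∃ (g : ℚ[X]) (m : ℕ), (∑ k ∈ Finset.range (M + 1), wellPoisedWeight x d r k *
      shiftedFac x d n r M k 0 ^ (2 * d)) * (x : K) ^ m =
      algebraMap ℚ[X] K (cyclotomic n ℚ ^ 4 * g) := by
  set P := cyclotomic n ℚ ^ 4 with hP
  -- In ℚ[X]/(Φ_n^4) the class of X is a unit, (X^n - 1)^4 vanishes, and 1 - X^m is invertible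
  -- whenever n does not divide m.
  have hXunit : IsUnit (AdjoinRoot.root P) :=
    isUnit_adjoinRoot_mk (isCoprime_X_cyclotomic hn).pow_right
  obtain ⟨q, hq⟩ := hXunit
  have hinv := exists_one_sub_unitPow_mul_eq_one (n := n) (q := q) fun m hm => by
    have := isUnit_adjoinRoot_mk (P := P) (isCoprime_one_sub_X_pow_cyclotomic hm).pow_right
    rwa [map_sub, map_one, map_pow, AdjoinRoot.mk_X, ← hq] at this
  choose! inv hinv using hinv
  have hq4 : (unitPow q n - 1) ^ 4 = 0 := by
    have : (AdjoinRoot.mk P) ((X ^ n - 1) ^ 4) = 0 := by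
      rw [AdjoinRoot.mk_eq_zero]
      exact pow_dvd_pow_of_dvd (cyclotomic.dvd_X_pow_sub_one n ℚ) 4
    rw [map_pow, map_sub, map_one, map_pow, AdjoinRoot.mk_X, ← hq] at this
    simpa [unitPow] using this
  have hc : (6 : AdjoinRoot P) * algebraMap ℚ (AdjoinRoot P) (1 / 6) = 1 := by
    rw [← map_ofNat (algebraMap ℚ (AdjoinRoot P)) 6, ← map_mul, ← map_one (algebraMap ℚ _)]
    norm_num
  have hzero := sum_wellPoised_eq_zero_of_paired hc hq4 hinv hd hD hM h1 h2 fun t =>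
    sum_wellPoisedWeight_mul_prod_shiftedFac_algebra q d n r M N D hd hr hM hND hN hDN hNM t
  set G := ∑ k ∈ Finset.range (M + 1), wellPoisedWeight laurentUnit d r k *
      shiftedFac laurentUnit d n r M k 0 ^ (2 * d) with hG
  -- A power of T turns the Laurent polynomial into a polynomial; vanishing in the quotient then
  -- means divisibility by Φ_n^4.
  obtain ⟨m, p, hp⟩ := LaurentPolynomial.exists_T_pow G
  have hGq : LaurentPolynomial.eval₂ (algebraMap ℚ (AdjoinRoot P)) q G = 0 := by
    rw [hG, map_sum, ← hzero]
    simp only [map_mul, map_pow, map_wellPoisedWeight, map_shiftedFac, map_laurentUnit]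
  have hpP : P ∣ p := by
    have := congrArg (LaurentPolynomial.eval₂ (algebraMap ℚ (AdjoinRoot P)) q) hp
    rw [map_mul, hGq, zero_mul, LaurentPolynomial.eval₂_toLaurent, hq,
      ← Polynomial.aeval_def, AdjoinRoot.aeval_eq, AdjoinRoot.mk_eq_zero] at this
    exact this
  obtain ⟨g, rfl⟩ := hpP
  refine ⟨g, m, ?_⟩
  have := congrArg (LaurentPolynomial.eval₂ (algebraMap ℚ K) x) hp
  rw [LaurentPolynomial.eval₂_toLaurent, map_mul, LaurentPolynomial.eval₂_T_n, hx,
    ← Polynomial.aeval_def, aeval_algebraMap_apply, aeval_X_left_apply, ← hx] at this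
  rw [this]
  congr 1
  rw [hG, map_sum]
  simp only [map_mul, map_pow, map_wellPoisedWeight, map_shiftedFac, map_laurentUnit]

end Cyclotomic

/-! ### Rational functions with denominator coprime to P. -/

section LocalRing

/-- The rational functions whose denominator can be chosen coprime to `P`. -/
noncomputable def coprimeDenomSubring (P : ℚ[X]) : Subring (RatFunc ℚ) where
  carrier := {x | ∃ a s : ℚ[X], IsCoprime s P ∧
    x * algebraMap ℚ[X] (RatFunc ℚ) s = algebraMap ℚ[X] (RatFunc ℚ) a}
  mul_mem' := by
    rintro x y ⟨a, s, hs, hx⟩ ⟨b, t, ht, hy⟩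
    refine ⟨a * b, s * t, hs.mul_left ht, ?_⟩
    rw [map_mul, map_mul, ← hx, ← hy]
    ring
  one_mem' := ⟨1, 1, isCoprime_one_left, by simp⟩
  add_mem' := by
    rintro x y ⟨a, s, hs, hx⟩ ⟨b, t, ht, hy⟩
    refine ⟨a * t + b * s, s * t, hs.mul_left ht, ?_⟩
    rw [map_add, map_mul, map_mul, map_mul, ← hx, ← hy]
    ring
  zero_mem' := ⟨0, 1, isCoprime_one_left, by simp⟩
  neg_mem' := by
    rintro x ⟨a, s, hs, hx⟩
    exact ⟨-a, s, hs, by rw [map_neg, ← hx, neg_mul]⟩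

theorem algebraMap_mem_coprimeDenomSubring (P a : ℚ[X]) :
    algebraMap ℚ[X] (RatFunc ℚ) a ∈ coprimeDenomSubring P :=
  ⟨a, 1, isCoprime_one_left, by simp⟩

theorem inv_algebraMap_mem_coprimeDenomSubring {P s : ℚ[X]} (hs : IsCoprime s P) :
    (algebraMap ℚ[X] (RatFunc ℚ) s)⁻¹ ∈ coprimeDenomSubring P := by
  by_cases h : s = 0
  · rw [h, map_zero, inv_zero]
    exact zero_mem _
  · exact ⟨1, s, hs, by rw [map_one, inv_mul_cancel₀ (RatFunc.algebraMap_ne_zero h)]⟩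

theorem dvd_num_of_mem_coprimeDenomSubring {P : ℚ[X]} {x : RatFunc ℚ}
    (hx : x ∈ coprimeDenomSubring P) : P ∣ (algebraMap ℚ[X] (RatFunc ℚ) P * x).num := by
  obtain ⟨a, s, hs, h⟩ := hx
  -- If s = 0, coprimality forces P to be a unit.
  by_cases hs0 : s = 0
  · rw [hs0, isCoprime_zero_left] at hs
    exact hs.dvd
  have : algebraMap ℚ[X] (RatFunc ℚ) P * x =
      algebraMap ℚ[X] (RatFunc ℚ) (P * a) / algebraMap ℚ[X] (RatFunc ℚ) s := by
    rw [eq_div_iff (RatFunc.algebraMap_ne_zero hs0), map_mul, ← h, mul_assoc]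
  have h2 := (RatFunc.num_mul_eq_mul_denom_iff hs0).2 this
  refine hs.symm.dvd_of_dvd_mul_right (z := s) ?_
  rw [h2, mul_assoc]
  exact dvd_mul_right _ _

end LocalRing

/-! ### The summands as rational functions. -/

section QSummand

/-- The indeterminate as a unit of the field of rational functions. -/
noncomputable def ratFuncUnit : (RatFunc ℚ)ˣ := Units.mk0 RatFunc.X RatFunc.X_ne_zero

theorem unitPow_ratFuncUnit (m : ℤ) : unitPow ratFuncUnit m = (RatFunc.X : RatFunc ℚ) ^ m := by
  rw [unitPow_eq_zpow]
  rfl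

theorem one_sub_X_pow_ne_zero {m : ℕ} (hm : m ≠ 0) : (1 - X ^ m : ℚ[X]) ≠ 0 := by
  intro h
  have := congrArg (eval 2) h
  simp only [eval_sub, eval_one, eval_pow, eval_X, eval_zero, sub_eq_zero] at this
  exact absurd this.symm (one_lt_pow₀ (by norm_num) hm).ne'

theorem algebraMap_one_sub_X_pow (m : ℕ) : algebraMap ℚ[X] (RatFunc ℚ) (1 - X ^ m) =
    1 - (RatFunc.X : RatFunc ℚ) ^ m := by simp

theorem qPochhammer_X_pow (d k : ℕ) :
    qPochhammer ((RatFunc.X : RatFunc ℚ) ^ d) (RatFunc.X ^ d) k =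
      algebraMap ℚ[X] (RatFunc ℚ) (∏ j ∈ Finset.range k, (1 - X ^ (d * (j + 1)))) := by
  rw [map_prod, qPochhammer]
  refine Finset.prod_congr rfl fun j _ => ?_
  rw [algebraMap_one_sub_X_pow]
  ring

theorem qPochhammer_X_zpow (d k : ℕ) (r : ℤ) :
    qPochhammer ((RatFunc.X : RatFunc ℚ) ^ r) (RatFunc.X ^ d) k =
      ∏ j ∈ Finset.range k, (1 - unitPow ratFuncUnit (r + d * j)) := by
  refine Finset.prod_congr rfl fun j _ => ?_
  rw [unitPow_ratFuncUnit, zpow_add₀ RatFunc.X_ne_zero, zpow_mul]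
  norm_cast

theorem qPochhammer_X_pow_ne_zero {d : ℕ} (hd : d ≠ 0) (k : ℕ) :
    qPochhammer ((RatFunc.X : RatFunc ℚ) ^ d) (RatFunc.X ^ d) k ≠ 0 := by
  rw [qPochhammer_X_pow]
  refine RatFunc.algebraMap_ne_zero (Finset.prod_ne_zero_iff.2 fun j _ => ?_)
  exact one_sub_X_pow_ne_zero (by positivity)

/-- The clearing factor does not depend on k, so it clears the whole sum up to M at once. -/
theorem qSummand_mul_eq {d : ℕ} (hd : d ≠ 0) (n : ℕ) (r : ℤ) {k M : ℕ} (hk : k ≤ M) :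
    qSummand (RatFunc.X : RatFunc ℚ) d r k *
      ((1 - RatFunc.X) * qPochhammer (RatFunc.X ^ d) (RatFunc.X ^ d) M ^ (2 * d)) =
      wellPoisedWeight ratFuncUnit d r k * shiftedFac ratFuncUnit d n r M k 0 ^ (2 * d) := by
  have hsplit : qPochhammer ((RatFunc.X : RatFunc ℚ) ^ d) (RatFunc.X ^ d) M =
      qPochhammer (RatFunc.X ^ d) (RatFunc.X ^ d) k *
        ∏ j ∈ Finset.Ico k M, (1 - unitPow ratFuncUnit (d * (j + 1))) := by
    rw [qPochhammer, ← Finset.prod_range_mul_prod_Ico _ hk, qPochhammer]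
    congr 1
    refine Finset.prod_congr rfl fun j _ => ?_
    rw [unitPow_ratFuncUnit, mul_add, mul_one, zpow_add₀ RatFunc.X_ne_zero, zpow_mul]
    norm_cast
    rw [mul_comm]
  have h1 : (1 - RatFunc.X : RatFunc ℚ) ≠ 0 := by
    have := RatFunc.algebraMap_ne_zero (one_sub_X_pow_ne_zero one_ne_zero)
    rwa [algebraMap_one_sub_X_pow, pow_one] at this
  have h2 := qPochhammer_X_pow_ne_zero hd k
  have h3 : shiftedFac ratFuncUnit d n r M k 0 =
      qPochhammer ((RatFunc.X : RatFunc ℚ) ^ r) (RatFunc.X ^ d) k *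
        ∏ j ∈ Finset.Ico k M, (1 - unitPow ratFuncUnit (d * (j + 1))) := by
    rw [qPochhammer_X_zpow]
    simp [shiftedFac]
  rw [hsplit, h3, qSummand, qInt, wellPoisedWeight, unitPow_ratFuncUnit, unitPow_ratFuncUnit,
    add_comm r, mul_pow, mul_pow]
  field_simp

variable {P : ℚ[X]}

theorem unitPow_mem_coprimeDenomSubring (hX : IsCoprime X P) (m : ℤ) :
    unitPow ratFuncUnit m ∈ coprimeDenomSubring P := by
  rw [unitPow_ratFuncUnit]
  obtain ⟨k, rfl | rfl⟩ := m.eq_nat_or_neg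
  · have := algebraMap_mem_coprimeDenomSubring P (X ^ k)
    simpa using this
  · have := inv_algebraMap_mem_coprimeDenomSubring (hX.pow_left (m := k))
    simpa using this

theorem inv_qPochhammer_mem {d k : ℕ} (h : ∀ j < k, IsCoprime (1 - X ^ (d * (j + 1))) P) :
    (qPochhammer ((RatFunc.X : RatFunc ℚ) ^ d) (RatFunc.X ^ d) k)⁻¹ ∈
      coprimeDenomSubring P := by
  rw [qPochhammer_X_pow]
  exact inv_algebraMap_mem_coprimeDenomSubring
    (IsCoprime.prod_left fun j hj => h j (Finset.mem_range.1 hj))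

theorem inv_one_sub_X_mem (h : IsCoprime (1 - X ^ 1) P) :
    (1 - RatFunc.X : RatFunc ℚ)⁻¹ ∈ coprimeDenomSubring P := by
  have := inv_algebraMap_mem_coprimeDenomSubring h
  rwa [algebraMap_one_sub_X_pow, pow_one] at this

/-- A summand whose numerator contains the factor `1 - q ^ (D n)` is divisible by `Φ_n ^ 4`. -/
theorem exists_qSummand_eq {d n D M k : ℕ} {r : ℤ} (hd : 2 ≤ d) (hn : 0 < n)
    (h1 : IsCoprime (1 - X ^ 1) (cyclotomic n ℚ ^ 4))
    (hM : (d : ℤ) * M = D * n - r) (hMk : M < k)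
    (h : ∀ j < k, IsCoprime (1 - X ^ (d * (j + 1))) (cyclotomic n ℚ ^ 4)) :
    ∃ y ∈ coprimeDenomSubring (cyclotomic n ℚ ^ 4), qSummand (RatFunc.X : RatFunc ℚ) d r k =
      algebraMap ℚ[X] (RatFunc ℚ) (cyclotomic n ℚ ^ 4) * y := by
  set R := coprimeDenomSubring (cyclotomic n ℚ ^ 4) with hR
  have hX : IsCoprime X (cyclotomic n ℚ ^ 4) := (isCoprime_X_cyclotomic hn).pow_right
  obtain ⟨g, hg⟩ : cyclotomic n ℚ ∣ 1 - X ^ (D * n) := by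
    rw [← dvd_neg, neg_sub, mul_comm, pow_mul]
    exact (cyclotomic.dvd_X_pow_sub_one n ℚ).trans (sub_one_dvd_pow_sub_one _ _)
  have hfac : 1 - unitPow ratFuncUnit (r + d * M) =
      algebraMap ℚ[X] (RatFunc ℚ) (cyclotomic n ℚ) * algebraMap ℚ[X] (RatFunc ℚ) g := by
    rw [← map_mul, ← hg, algebraMap_one_sub_X_pow, unitPow_ratFuncUnit,
      show r + (d : ℤ) * M = ((D * n : ℕ) : ℤ) by push_cast; linear_combination hM, zpow_natCast]
  set c := ∏ j ∈ (Finset.range k).erase M, (1 - unitPow ratFuncUnit (r + d * j)) with hc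
  have hcR : c ∈ R := prod_mem fun j _ => sub_mem (one_mem _) (unitPow_mem_coprimeDenomSubring hX _)
  have hP : qPochhammer ((RatFunc.X : RatFunc ℚ) ^ r) (RatFunc.X ^ d) k =
      algebraMap ℚ[X] (RatFunc ℚ) (cyclotomic n ℚ) * (algebraMap ℚ[X] (RatFunc ℚ) g * c) := by
    rw [qPochhammer_X_zpow, ← Finset.mul_prod_erase _ _ (Finset.mem_range.2 hMk), hfac, mul_assoc]
  -- The factor with j = M contributes Φ_n to the power 2d; four copies are split off and 2d - 4
  -- stay in the witness.
  refine ⟨(1 - unitPow ratFuncUnit (2 * d * k + r)) * (1 - RatFunc.X)⁻¹ *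
    (algebraMap ℚ[X] (RatFunc ℚ) (cyclotomic n ℚ) ^ (2 * d - 4) *
      (algebraMap ℚ[X] (RatFunc ℚ) g * c) ^ (2 * d) *
      (qPochhammer (RatFunc.X ^ d) (RatFunc.X ^ d) k)⁻¹ ^ (2 * d)) *
    unitPow ratFuncUnit (d * (d - 1 - r) * k), ?_, ?_⟩
  · refine mul_mem (mul_mem (mul_mem ?_ ?_) (mul_mem (mul_mem ?_ ?_) ?_)) ?_
    · exact sub_mem (one_mem _) (unitPow_mem_coprimeDenomSubring hX _)
    · exact inv_one_sub_X_mem h1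
    · exact pow_mem (algebraMap_mem_coprimeDenomSubring _ _) _
    · exact pow_mem (mul_mem (algebraMap_mem_coprimeDenomSubring _ _) hcR) _
    · exact pow_mem (inv_qPochhammer_mem h) _
    · exact unitPow_mem_coprimeDenomSubring hX _
  · rw [qSummand, qInt, hP, unitPow_ratFuncUnit, unitPow_ratFuncUnit, mul_pow, map_pow,
      div_eq_mul_inv, div_eq_mul_inv, ← inv_pow]
    nth_rw 1 [show 2 * d = 4 + (2 * d - 4) by omega]
    rw [pow_add]
    ring

end QSummand

/-! ### Assembly of both congruences. -/

theorem theorem1 (d n : ℕ) (r : ℤ) (hd : 3 ≤ d) (hr : r ≤ (d : ℤ) - 2)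
    (hn : (d : ℤ) - r ≤ (n : ℤ)) (hdr : IsCoprime (d : ℤ) r) (hnr : (n : ℤ) ≡ -r [ZMOD (d : ℤ)]) :
    RatFuncCongr (cyclotomic n ℚ ^ 4)
      (∑ k ∈ Finset.Icc 0 (n - 1), qSummand (RatFunc.X : RatFunc ℚ) d r k) 0 ∧
    ∃ M : ℕ, (d : ℤ) * (M : ℤ) = ((d : ℤ) - 1) * (n : ℤ) - r ∧ M ≤ n - 1 ∧
      RatFuncCongr (cyclotomic n ℚ ^ 4)
        (∑ k ∈ Finset.Icc 0 M, qSummand (RatFunc.X : RatFunc ℚ) d r k) 0 := by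
  obtain ⟨D, rfl⟩ : ∃ D, d = D + 1 := ⟨d - 1, by omega⟩
  have hn2 : 2 ≤ n := by omega
  obtain ⟨w, hw⟩ := hnr.symm.dvd
  have hw1 : 1 ≤ w := by
    by_contra hlt
    have : ((D + 1 : ℕ) : ℤ) * w ≤ 0 := mul_nonpos_of_nonneg_of_nonpos (by positivity) (by omega)
    omega
  obtain ⟨N, hN⟩ : ∃ N : ℕ, w = N + 1 := ⟨(w - 1).toNat, by omega⟩
  subst hN
  have hN : r + n = ((D + 1 : ℕ) : ℤ) * (N + 1) := by linear_combination hw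
  -- Here n - 1 - N = DN + (d - 1 - r), so r ≤ d - 2 is exactly the degree condition DN < M of the
  -- interpolation argument.
  have hND : (D * N : ℤ) + 1 ≤ (n : ℤ) - 1 - N := by
    push_cast at hN hr
    linarith
  have hDN0 : (0 : ℤ) ≤ D * N := by positivity
  obtain ⟨M, hMn⟩ : ∃ M : ℕ, (M : ℤ) = n - 1 - N := ⟨(n - 1 - N : ℤ).toNat, by omega⟩
  have hM : ((D + 1 : ℕ) : ℤ) * M = D * n - r := by
    rw [hMn]
    push_cast at hN ⊢
    linear_combination hN
  have hMN : (M : ℤ) = D * N + (((D + 1 : ℕ) : ℤ) - 1 - r) := by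
    push_cast at hN ⊢
    linear_combination hMn + hN
  have hDN : D * N < M := by
    zify
    omega
  have hNM : N ≤ M := (Nat.le_mul_of_pos_left N (by omega)).trans hDN.le
  have hMn' : M ≤ n - 1 := by omega
  have hcop : IsCoprime (n : ℤ) ((D + 1 : ℕ) : ℤ) := by
    have : (n : ℤ) = -r + ((D + 1 : ℕ) : ℤ) * (N + 1) := by linear_combination hN
    rw [this]
    exact (IsCoprime.neg_left hdr.symm).add_mul_left_left _
  have hr0 : ∀ m : ℤ, r + ((D + 1 : ℕ) : ℤ) * m ≠ 0 := by
    intro m hm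
    have h1 : ((D + 1 : ℕ) : ℤ) ∣ r := ⟨-m, by linear_combination hm⟩
    have := Int.isUnit_iff.1 (hdr.isUnit_of_dvd' dvd_rfl h1)
    omega
  have h2 : ∀ j < n - 1, ¬ (n : ℤ) ∣ ((D + 1 : ℕ) : ℤ) * (j + 1) := by
    intro j hj h
    have := Int.le_of_dvd (by positivity) (hcop.dvd_of_dvd_mul_left h)
    omega
  -- Reflection again: Dn - (r + dj) = d(M - j), which reduces the claim to `h2`.
  have h1 : ∀ j < M, ¬ (n : ℤ) ∣ r + ((D + 1 : ℕ) : ℤ) * j := by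
    intro j hj h
    refine h2 (M - j - 1) (by omega) ?_
    have e : (((M - j - 1 : ℕ) : ℤ) + 1) = M - j := by omega
    rw [e]
    have := dvd_sub (dvd_mul_left (n : ℤ) D) h
    rwa [show (D : ℤ) * n - (r + ((D + 1 : ℕ) : ℤ) * j) = ((D + 1 : ℕ) : ℤ) * (M - j) by
      linear_combination -hM] at this
  have hcoprime : ∀ j < n - 1, IsCoprime (1 - X ^ ((D + 1) * (j + 1))) (cyclotomic n ℚ ^ 4) := by
    intro j hj
    refine (isCoprime_one_sub_X_pow_cyclotomic fun h => h2 j hj ?_).pow_right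
    exact_mod_cast h
  have hone : IsCoprime (1 - X ^ 1) (cyclotomic n ℚ ^ 4) :=
    (isCoprime_one_sub_X_pow_cyclotomic fun h => by have := Nat.le_of_dvd one_pos h; omega).pow_right
  have hX : IsCoprime X (cyclotomic n ℚ ^ 4) := (isCoprime_X_cyclotomic (by omega)).pow_right
  set R := coprimeDenomSubring (cyclotomic n ℚ ^ 4) with hR
  have hmain : ∃ y ∈ R, ∑ k ∈ Finset.Icc 0 M, qSummand (RatFunc.X : RatFunc ℚ) (D + 1) r k =
      algebraMap ℚ[X] (RatFunc ℚ) (cyclotomic n ℚ ^ 4) * y := by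
    obtain ⟨g, m, hg⟩ := exists_sum_wellPoised_eq (D + 1) r M N D (by omega : 0 < n) rfl (by omega)
      hr0 hM hMN hN hDN hNM h1 (fun j hj => h2 j (by omega)) ratFuncUnit
      (by rw [RatFunc.algebraMap_X]; rfl)
    have hsum : (∑ k ∈ Finset.Icc 0 M, qSummand (RatFunc.X : RatFunc ℚ) (D + 1) r k) *
        ((1 - RatFunc.X) *
          qPochhammer (RatFunc.X ^ (D + 1)) (RatFunc.X ^ (D + 1)) M ^ (2 * (D + 1))) =
        ∑ k ∈ Finset.range (M + 1), wellPoisedWeight ratFuncUnit (D + 1) r k *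
          shiftedFac ratFuncUnit (D + 1) n r M k 0 ^ (2 * (D + 1)) := by
      rw [Finset.sum_mul, ← Nat.range_succ_eq_Icc_zero]
      refine Finset.sum_congr rfl fun k hk => ?_
      exact qSummand_mul_eq (by omega) n r (by have := Finset.mem_range.1 hk; omega)
    have hx0 : (1 - RatFunc.X : RatFunc ℚ) ≠ 0 := by
      have := RatFunc.algebraMap_ne_zero (one_sub_X_pow_ne_zero one_ne_zero)
      rwa [algebraMap_one_sub_X_pow, pow_one] at this
    have hq0 := qPochhammer_X_pow_ne_zero (d := D + 1) (by omega) M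
    refine ⟨algebraMap ℚ[X] (RatFunc ℚ) g * (unitPow ratFuncUnit (-m) * ((1 - RatFunc.X)⁻¹ *
      (qPochhammer (RatFunc.X ^ (D + 1)) (RatFunc.X ^ (D + 1)) M)⁻¹ ^ (2 * (D + 1)))), ?_, ?_⟩
    · refine mul_mem (algebraMap_mem_coprimeDenomSubring _ _)
        (mul_mem (unitPow_mem_coprimeDenomSubring hX _) (mul_mem (inv_one_sub_X_mem hone)
          (pow_mem (inv_qPochhammer_mem fun j hj => hcoprime j (by omega)) _)))
    · rw [← hsum, map_mul] at hg
      have hxm : ((ratFuncUnit : (RatFunc ℚ)ˣ) : RatFunc ℚ) ^ m *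
          unitPow ratFuncUnit (-m) = 1 := by
        have : unitPow ratFuncUnit (m : ℤ) * unitPow ratFuncUnit (-m) = 1 := by
          rw [← unitPow_add, ← unitPow_zero ratFuncUnit]; congr 1; ring
        rwa [unitPow_eq_zpow, zpow_natCast] at this
      rw [← mul_assoc, ← hg]
      set S := ∑ k ∈ Finset.Icc 0 M, qSummand (RatFunc.X : RatFunc ℚ) (D + 1) r k
      set Q := qPochhammer ((RatFunc.X : RatFunc ℚ) ^ (D + 1)) (RatFunc.X ^ (D + 1)) M
      have e1 : (1 - RatFunc.X : RatFunc ℚ) * (1 - RatFunc.X)⁻¹ = 1 := mul_inv_cancel₀ hx0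
      have e2 : Q ^ (2 * (D + 1)) * Q⁻¹ ^ (2 * (D + 1)) = 1 := by
        rw [← mul_pow, mul_inv_cancel₀ hq0, one_pow]
      calc S = S * (((1 - RatFunc.X : RatFunc ℚ) * (1 - RatFunc.X)⁻¹) *
            (Q ^ (2 * (D + 1)) * Q⁻¹ ^ (2 * (D + 1))) *
            (((ratFuncUnit : (RatFunc ℚ)ˣ) : RatFunc ℚ) ^ m * unitPow ratFuncUnit (-m))) := by
              rw [e1, e2, hxm]; ring
        _ = _ := by ring
  obtain ⟨y, hy, hMy⟩ := hmain
  have hcongr : ∀ S : RatFunc ℚ, (∃ y ∈ R, S =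
      algebraMap ℚ[X] (RatFunc ℚ) (cyclotomic n ℚ ^ 4) * y) →
      RatFuncCongr (cyclotomic n ℚ ^ 4) S 0 := by
    rintro S ⟨y, hy, rfl⟩
    rw [RatFuncCongr, sub_zero]
    exact dvd_num_of_mem_coprimeDenomSubring hy
  refine ⟨hcongr _ ?_, M, by rw [hM]; push_cast; ring, hMn', hcongr _ ⟨y, hy, hMy⟩⟩
  -- The terms with M < k ≤ n - 1 are separately divisible by Φ_n^4, so the full sum inherits the
  -- congruence from the sum up to M.
  have htail : ∀ k, ∃ z ∈ R, M < k ∧ k ≤ n - 1 →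
      qSummand (RatFunc.X : RatFunc ℚ) (D + 1) r k =
        algebraMap ℚ[X] (RatFunc ℚ) (cyclotomic n ℚ ^ 4) * z := by
    intro k
    by_cases hk : M < k ∧ k ≤ n - 1
    · obtain ⟨z, hz, h⟩ := exists_qSummand_eq (by omega) (by omega) hone hM hk.1
        fun j hj => hcoprime j (by omega)
      exact ⟨z, hz, fun _ => h⟩
    · exact ⟨0, zero_mem _, fun h => absurd h hk⟩
  choose z hzR hz using htail
  refine ⟨y + ∑ k ∈ Finset.Ico (M + 1) (n - 1 + 1), z k,
    add_mem hy (sum_mem fun k _ => hzR k), ?_⟩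
  rw [← Nat.range_succ_eq_Icc_zero, ← Finset.sum_range_add_sum_Ico _ (by omega : M + 1 ≤ n - 1 + 1),
    Nat.range_succ_eq_Icc_zero, hMy, mul_add, Finset.mul_sum]
  congr 1
  refine Finset.sum_congr rfl fun k hk => hz k ?_
  rw [Finset.mem_Ico] at hk
  omega
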